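/- Conventions. All graphs are finite and simple, and all asymptotics are for infinite families of graphs indexed by $n\to\infty$; indices $n$ are suppressed. A graph is approximately strongly regular with parameters $(v,k,\lambda,\mu;\sigma)$, $\sigma\ge 0$, if it is $k$-regular of order $v$, neither complete nor edgeless, the number of common neighbours of an adjacent pair of vertices has average $\lambda$ and variance at most $\sigma^2$ (over all adjacent pairs), and the number of common neighbours of a distinct nonadjacent pair has average $\mu$ and variance at most $\sigma^2$ (over all such pairs). A $k$-regular graph (family) is optimally pseudorandom if the second largest absolute value of an eigenvalue of its adjacency matrix is $O(\sqrt{k})$. Statement. Let $m\ge 5$ be fixed and let $\Gamma$ be an optimally pseudorandom $K_m$-free $k$-regular graph of order $v$ (that is, a family of such graphs). Let $i \geq 0$ be a fixed integer, let $Y$ be a clique of size $i$ in $\Gamma$, and let $\Gamma_i$ be the subgraph of $\Gamma$ induced on the set of common neighbours of $Y$. Suppose that $\Gamma_i$ is approximately strongly regular with parameters $(v_i,k_i,\lambda_i,\mu_i;\sigma_i)$ (in particular regular) and that (P1) $k_i\ge (1+o(1))\,k\left(\frac{k}{v}\right)^i$ and $(1+o(1))\frac{k}{v}\le \frac{k_i}{v_i}=o(1)$.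 Suppose further that $i=m-3$ or that (P2) the smallest eigenvalue $s_i$ of the adjacency matrix of $\Gamma_i$ satisfies $-s_i=O(\mu_i-\lambda_i)$, meaning that there is a constant $C>0$ with $-s_i\le C(\mu_i-\lambda_i)$ for all sufficiently large $n$. Then the following hold. (i) If $i=\frac34 m-\frac32$ and $\sigma_i=o\!\left(\sqrt{k}\left(\frac{k}{v}\right)^{\frac34 m-\frac12}\right)$, then $k=O\!\left(v^{1-\frac{2}{3m-4}}\right)$. (ii) If $i=m-3$ and $\sigma_{m-3}=o\!\left(\sqrt{k}\left(\frac{k}{v}\right)^{\frac12 m+1}\right)$, then $k=O\!\left(v^{1-\frac{1}{m+1}}\right)$. -/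

import Mathlib

open Filter Topology Asymptotics

noncomputable section

namespace ApproxSRG

universe u

section Single

variable {V : Type u} [Fintype V]

/-- The number of common neighbours of `a` and `b`, as a real number; this is `λ_{ab}` for
adjacent and `μ_{ab}` for distinct nonadjacent `a`, `b`. -/
def commonCount (G : SimpleGraph V) (a b : V) : ℝ :=
  ((G.commonNeighbors a b).ncard : ℝ)

open scoped Classical in
/-- The set `Λ` of (ordered) pairs of adjacent vertices. -/
def adjPairs (G : SimpleGraph V) : Finset (V × V) :=
  Finset.univ.filter fun p => G.Adj p.1 p.2

open scoped Classical in
/-- The set `M` of (ordered) pairs of distinct nonadjacent vertices. -/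
def nonadjPairs (G : SimpleGraph V) : Finset (V × V) :=
  Finset.univ.filter fun p => p.1 ≠ p.2 ∧ ¬ G.Adj p.1 p.2

/-- The average of `f` over the finite set `P`. -/
def mean {α : Type u} (P : Finset α) (f : α → ℝ) : ℝ :=
  (∑ p ∈ P, f p) / (P.card : ℝ)

open scoped Classical in
/-- `G` is an approximately strongly regular graph with parameters `(v, k, lam, mu; sig)`. -/
structure IsApproxSRG (G : SimpleGraph V) (v k : ℕ) (lam mu sig : ℝ) : Prop where
  card_eq : Fintype.card V = v
  regular : G.IsRegularOfDegree k
  not_complete : G ≠ ⊤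
  not_edgeless : G ≠ ⊥
  sig_nonneg : 0 ≤ sig
  mean_adj : mean (adjPairs G) (fun p => commonCount G p.1 p.2) = lam
  var_adj : mean (adjPairs G) (fun p => (commonCount G p.1 p.2 - lam) ^ 2) ≤ sig ^ 2
  mean_nonadj : mean (nonadjPairs G) (fun p => commonCount G p.1 p.2) = mu
  var_nonadj : mean (nonadjPairs G) (fun p => (commonCount G p.1 p.2 - mu) ^ 2) ≤ sig ^ 2

open scoped Classical in
/-- The eigenvalues, with multiplicity, of the adjacency matrix of `G`. -/
def adjEigenvalues (G : SimpleGraph V) : V → ℝ :=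
  Matrix.IsHermitian.eigenvalues (A := G.adjMatrix ℝ) (by
    rw [Matrix.IsHermitian, Matrix.conjTranspose_eq_transpose_of_trivial]
    exact G.transpose_adjMatrix)

/-- The smallest eigenvalue of the adjacency matrix. -/
def smallestEigenvalue (G : SimpleGraph V) : ℝ :=
  ⨅ x, adjEigenvalues G x

/-- The second largest absolute value of an eigenvalue of the adjacency matrix, where the
eigenvalues are counted with multiplicity (`0` when there are fewer than two eigenvalues). -/
def secondAbsEigenvalue (G : SimpleGraph V) : ℝ :=
  ((Finset.univ.val.map fun x => |adjEigenvalues G x|).sort (· ≥ ·)).getD 1 0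

/-- The set of common neighbours of all the vertices in `Y` (everything if `Y` is empty). -/
def commonNbhd (G : SimpleGraph V) (Y : Finset V) : Set V :=
  {x | ∀ y ∈ Y, G.Adj y x}

instance commonNbhdFintype (G : SimpleGraph V) (Y : Finset V) : Fintype (commonNbhd G Y) :=
  Fintype.ofFinite _

/-- The induced subgraph `Γ(Y)` on the common neighbourhood of `Y`. -/
def link (G : SimpleGraph V) (Y : Finset V) : SimpleGraph (commonNbhd G Y) :=
  G.induce (commonNbhd G Y)

end Single

section Family

open scoped Classical in
/-- `G` is a family of `k`-regular graphs of order `v` that is optimally pseudorandom. -/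
structure IsOptimallyPseudorandom {V : ℕ → Type u} [∀ n, Fintype (V n)]
    (G : ∀ n, SimpleGraph (V n)) (v k : ℕ → ℕ) : Prop where
  card_eq : ∀ n, Fintype.card (V n) = v n
  regular : ∀ n, (G n).IsRegularOfDegree (k n)
  second_eigenvalue :
    (fun n => secondAbsEigenvalue (G n)) =O[atTop] fun n => √(k n : ℝ)

/-- Property (P1) of a family `H` of graphs (the links of `i`-cliques in `k`-regular graphs of
order `v`): `H` has `v'` vertices and `v' k' / 2` edges, `k' ≥ (1 + o(1)) k (k / v) ^ i`, and
`(1 + o(1)) k / v ≤ k' / v' = o(1)`. -/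
structure PropertyP1 {W : ℕ → Type u} [∀ n, Fintype (W n)]
    (H : ∀ n, SimpleGraph (W n)) (v k : ℕ → ℕ) (i : ℕ) (v' : ℕ → ℕ) (k' : ℕ → ℝ) :
    Prop where
  card_eq : ∀ n, Fintype.card (W n) = v' n
  edges_eq : ∀ n, ((H n).edgeSet.ncard : ℝ) = (v' n : ℝ) * k' n / 2
  degree_ge : ∃ ε : ℕ → ℝ, Tendsto ε atTop (𝓝 0) ∧
    ∀ n, (1 + ε n) * ((k n : ℝ) * ((k n : ℝ) / (v n : ℝ)) ^ i) ≤ k' n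
  density_ge : ∃ ε : ℕ → ℝ, Tendsto ε atTop (𝓝 0) ∧
    ∀ n, (1 + ε n) * ((k n : ℝ) / (v n : ℝ)) ≤ k' n / (v' n : ℝ)
  density_tendsto : Tendsto (fun n => k' n / (v' n : ℝ)) atTop (𝓝 0)

/-- Property (P2) of a family `H` of graphs: `H` is approximately strongly regular with
parameters `(v', k', lam, mu; sig)` and its smallest eigenvalue `s` satisfies
`-s = O(mu - lam)`; the sign of `mu - lam` matters, so the bound is one-sided. -/
structure PropertyP2 {W : ℕ → Type u} [∀ n, Fintype (W n)]
    (H : ∀ n, SimpleGraph (W n)) (v' k' : ℕ → ℕ) (lam mu sig : ℕ → ℝ) : Prop where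
  approxSRG : ∀ n, IsApproxSRG (H n) (v' n) (k' n) (lam n) (mu n) (sig n)
  smallest_eigenvalue : ∃ C : ℝ, 0 < C ∧
    ∀ᶠ n in atTop, -smallestEigenvalue (H n) ≤ C * (mu n - lam n)

end Family

end ApproxSRG

end

/-! Let the link be `K_{t+2}`-free, with density `p = k' / v'`, smallest eigenvalue `s`, and
nonnegative shift `r`, which is `0` or an eigenvalue with eigenvector orthogonal to `1`. Three
inequalities between `r` and `s` close a loop. Cliques: Hoffman's bound, iterated through
neighbourhoods, gives `k' p^t ≤ 2^t (-s)` (`degree_mul_pow_le_of_cliqueFree`). Krein: the Schur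
square of the positive semidefinite matrix `r - A + pJ` lies in the span of `1`, `A`, `J`, so `-s =
O(r^2 + r p)` for small `p` (`neg_smallestEigenvalue_le_of_posSemidef`). Quadratic: `A^2` is that of
a strongly regular graph up to Frobenius error `v' σ`, so `(μ - λ) r ≤ k' + v' σ` (from
`eigenvalue_quadratic_le`). If `μ - λ` is at least a constant times `k' p^t`, then `r p^t = O(1 +
σ/p)`, hence `k' p^(3t) = O(1 + (σ/p)^2)`. That lower bound follows from (P2) and the clique
inequality, or, for triangle-free links (`t = 1`), from `λ = 0` and counting paths of length two. By
(P1) and the bound on `σ`, `k (k/v)^D = O(1)` with `D = i + 3t` (`isBigO_of_link_bound`). -/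

namespace ApproxSRG

universe u

/-! ### Extreme eigenvalues and the Frobenius bound for real matrices. -/

section LinearAlgebra

open Matrix

variable {W : Type u} [Fintype W]

/-- The least eigenvalue of a real symmetric matrix is attained and bounds the quadratic form. -/
theorem exists_eigenvector_iInf_eigenvalues [DecidableEq W] [Nonempty W] {A : Matrix W W ℝ} (hA : A.IsHermitian) :
    (∃ x : W → ℝ, x ≠ 0 ∧ A *ᵥ x = (⨅ j, hA.eigenvalues j) • x) ∧
      (A - (⨅ j, hA.eigenvalues j) • (1 : Matrix W W ℝ)).PosSemidef := by
  set s := ⨅ j, hA.eigenvalues j with hs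
  constructor
  · obtain ⟨j, hj⟩ := exists_eq_ciInf_of_finite (f := hA.eigenvalues)
    refine ⟨(hA.eigenvectorBasis j).ofLp, ?_, ?_⟩
    · intro h
      have h1 := hA.eigenvectorBasis.orthonormal.ne_zero j
      apply h1
      ext a
      exact congrFun h a
    · rw [hA.mulVec_eigenvectorBasis j, hj]
  · have h1 : A - s • (1 : Matrix W W ℝ) =
        Unitary.conjStarAlgAut ℝ _ hA.eigenvectorUnitary
          (diagonal fun j => hA.eigenvalues j - s) := by
      have h2 : (diagonal fun j => hA.eigenvalues j - s) =
          diagonal (RCLike.ofReal ∘ hA.eigenvalues) - s • (1 : Matrix W W ℝ) := by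
        ext a b
        by_cases hab : a = b
        · subst hab; simp
        · simp [hab]
      rw [h2, map_sub, map_smul, map_one, ← hA.spectral_theorem]
    rw [h1, Unitary.conjStarAlgAut_apply]
    refine PosSemidef.mul_mul_conjTranspose_same (PosSemidef.diagonal fun j => ?_) _
    exact sub_nonneg.2 (ciInf_le (Set.finite_range _).bddBelow j)

/-- A real symmetric matrix has a largest eigenvalue, which bounds the quadratic form. -/
theorem exists_max_eigenvector [DecidableEq W] [Nonempty W] {A : Matrix W W ℝ} (hA : A.IsHermitian) :
    ∃ r : ℝ, (∃ x : W → ℝ, x ≠ 0 ∧ A *ᵥ x = r • x) ∧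
      (r • (1 : Matrix W W ℝ) - A).PosSemidef := by
  obtain ⟨⟨x, hx, hAx⟩, h⟩ := exists_eigenvector_iInf_eigenvalues hA.neg
  refine ⟨-⨅ j, hA.neg.eigenvalues j, ⟨x, hx, ?_⟩, ?_⟩
  · rw [neg_smul, ← hAx, neg_mulVec, neg_neg]
  · convert h using 1
    rw [neg_smul]; abel

/-- The quadratic form of a matrix is bounded by the Frobenius norm. -/
theorem quadForm_le_of_sum_sq_le {E : Matrix W W ℝ} {c : ℝ} (hc : 0 ≤ c)
    (hE : ∑ a, ∑ b, E a b ^ 2 ≤ c ^ 2) (x : W → ℝ) :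
    x ⬝ᵥ (E *ᵥ x) ≤ c * (x ⬝ᵥ x) := by
  have hxx : 0 ≤ x ⬝ᵥ x := dotProduct_self_star_nonneg x
  have h1 : x ⬝ᵥ (E *ᵥ x) = ∑ p : W × W, E p.1 p.2 * (x p.1 * x p.2) := by
    rw [Fintype.sum_prod_type]
    simp only [dotProduct, mulVec, Finset.mul_sum]
    exact Finset.sum_congr rfl fun a _ => Finset.sum_congr rfl fun b _ => by ring
  have h2 : ∑ p : W × W, (x p.1 * x p.2) ^ 2 = (x ⬝ᵥ x) ^ 2 := by
    rw [Fintype.sum_prod_type, sq (x ⬝ᵥ x)]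
    simp only [dotProduct, Finset.sum_mul_sum]
    exact Finset.sum_congr rfl fun a _ => Finset.sum_congr rfl fun b _ => by ring
  have h3 : ∑ p : W × W, E p.1 p.2 ^ 2 ≤ c ^ 2 := by
    rw [Fintype.sum_prod_type]; exact hE
  -- Cauchy–Schwarz for `E` against the rank-one matrix `x xᵀ`, of Frobenius norm `x ⬝ᵥ x`.
  have h4 := Finset.sum_mul_sq_le_sq_mul_sq Finset.univ (fun p : W × W => E p.1 p.2)
    (fun p => x p.1 * x p.2)
  rw [h2, ← h1] at h4
  refine abs_le_of_sq_le_sq' (h4.trans ?_) (by positivity) |>.2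
  rw [mul_pow]
  gcongr

end LinearAlgebra

/-! ### Spectrum of a regular graph and the Krein-type inequality. -/

section Regular

open Matrix
open scoped Classical

variable {W : Type u} [Fintype W] {H : SimpleGraph W} {k : ℕ}

theorem adjMatrix_mulVec_one (hreg : H.IsRegularOfDegree k) :
    H.adjMatrix ℝ *ᵥ (1 : W → ℝ) = (k : ℝ) • (1 : W → ℝ) := by
  ext a
  have := H.adjMatrix_mulVec_const_apply_of_regular (a := (1 : ℝ)) hreg (v := a)
  simpa [Function.const_def] using this

theorem sum_eq_zero_of_eigenvector (hreg : H.IsRegularOfDegree k) {θ : ℝ} (hθ : θ ≠ k)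
    {x : W → ℝ} (hx : H.adjMatrix ℝ *ᵥ x = θ • x) : ∑ a, x a = 0 := by
  have h1 : (1 : W → ℝ) ⬝ᵥ (H.adjMatrix ℝ *ᵥ x) = k * ∑ a, x a := by
    rw [dotProduct_mulVec, ← mulVec_transpose, H.transpose_adjMatrix, adjMatrix_mulVec_one hreg,
      smul_dotProduct, one_dotProduct, smul_eq_mul]
  rw [hx, dotProduct_smul, one_dotProduct, smul_eq_mul] at h1
  have h2 : (θ - k) * ∑ a, x a = 0 := by linarith
  exact (mul_eq_zero.1 h2).resolve_left (sub_ne_zero.2 hθ)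

theorem smallestEigenvalue_spec [Nonempty W] (H : SimpleGraph W) :
    (∃ x : W → ℝ, x ≠ 0 ∧ H.adjMatrix ℝ *ᵥ x = smallestEigenvalue H • x) ∧
      (H.adjMatrix ℝ - smallestEigenvalue H • (1 : Matrix W W ℝ)).PosSemidef :=
  exists_eigenvector_iInf_eigenvalues _

theorem smallestEigenvalue_nonpos [Nonempty W] (H : SimpleGraph W) :
    smallestEigenvalue H ≤ 0 := by
  have h := (smallestEigenvalue_spec H).2.diag_nonneg (i := Classical.arbitrary W)
  simpa using h

theorem smallestEigenvalue_mul_le [Nonempty W] (H : SimpleGraph W) (y : W → ℝ) :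
    smallestEigenvalue H * (y ⬝ᵥ y) ≤ y ⬝ᵥ (H.adjMatrix ℝ *ᵥ y) := by
  have h := (smallestEigenvalue_spec H).2.dotProduct_mulVec_nonneg y
  rw [sub_mulVec, smul_mulVec, one_mulVec, dotProduct_sub, dotProduct_smul, star_trivial,
    smul_eq_mul] at h
  linarith

/-- A shift `r` of the adjacency matrix `A` of a regular graph making `r - A + (k / v) J` positive
semidefinite, and which is `0` or an eigenvalue of `A` with an eigenvector orthogonal to `1`. -/
theorem exists_nonneg_shift [Nonempty W] (hreg : H.IsRegularOfDegree k) :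
    ∃ r : ℝ, 0 ≤ r ∧
      (r • (1 : Matrix W W ℝ) - H.adjMatrix ℝ +
        ((k : ℝ) / Fintype.card W) • Matrix.of fun _ _ => (1 : ℝ)).PosSemidef ∧
      (r = 0 ∨ ∃ x : W → ℝ, x ≠ 0 ∧ ∑ a, x a = 0 ∧ H.adjMatrix ℝ *ᵥ x = r • x) := by
  set c : ℝ := (k : ℝ) / Fintype.card W with hc
  set J : Matrix W W ℝ := Matrix.of fun _ _ => (1 : ℝ) with hJ
  have hv : (Fintype.card W : ℝ) ≠ 0 := by exact_mod_cast Fintype.card_ne_zero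
  have hJx : ∀ x : W → ℝ, J *ᵥ x = (∑ a, x a) • (1 : W → ℝ) := by
    intro x; ext a; simp [hJ, mulVec, dotProduct]
  -- With `c = k / |W|` the all-ones vector lies in the kernel of `A - cJ`, so eigenvectors of
  -- nonzero eigenvalue are orthogonal to it.
  have hherm : (H.adjMatrix ℝ - c • J).IsHermitian := by
    ext a b
    simp [hJ, SimpleGraph.adj_comm]
  obtain ⟨r, ⟨x, hx, hAx⟩, hpsd⟩ := exists_max_eigenvector hherm
  rcases le_or_gt r 0 with hr | hr
  · refine ⟨0, le_rfl, ?_, Or.inl rfl⟩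
    have := hpsd.add (PosSemidef.one.smul (neg_nonneg.2 hr) : ((-r) • (1 : Matrix W W ℝ)).PosSemidef)
    convert this using 1
    rw [zero_smul, neg_smul]; abel
  · refine ⟨r, hr.le, ?_, Or.inr ⟨x, hx, ?_⟩⟩
    · convert hpsd using 1
      abel
    · have hsum : ∑ a, x a = 0 := by
        have h1 : (1 : W → ℝ) ⬝ᵥ ((H.adjMatrix ℝ - c • J) *ᵥ x) = 0 := by
          rw [sub_mulVec, dotProduct_sub, dotProduct_mulVec, ← mulVec_transpose,
            H.transpose_adjMatrix, adjMatrix_mulVec_one hreg, smul_mulVec, hJx]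
          simp [one_dotProduct, hc]
          field_simp
          ring
        rw [hAx, dotProduct_smul, one_dotProduct, smul_eq_mul] at h1
        exact (mul_eq_zero.1 h1).resolve_left hr.ne'
      refine ⟨hsum, ?_⟩
      rw [← hAx, sub_mulVec, smul_mulVec, hJx, hsum]
      simp

/-- A Krein-type inequality: the smallest eigenvalue of a regular graph is controlled by the square
of its second largest eigenvalue. -/
theorem neg_smallestEigenvalue_le_of_posSemidef [Nonempty W] (hreg : H.IsRegularOfDegree k)
    (hk : 0 < k) {r c : ℝ}
    (h : (r • (1 : Matrix W W ℝ) - H.adjMatrix ℝ +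
        c • Matrix.of fun _ _ => (1 : ℝ)).PosSemidef) :
    (1 - 2 * c) * -smallestEigenvalue H ≤ r ^ 2 + 2 * r * c := by
  obtain ⟨x, hx, hAx⟩ := (smallestEigenvalue_spec H).1
  have hs := smallestEigenvalue_nonpos H
  set s := smallestEigenvalue H
  have hk' : (0 : ℝ) < k := by exact_mod_cast hk
  have hsum : ∑ a, x a = 0 := sum_eq_zero_of_eigenvector hreg (by linarith) hAx
  -- Schur product theorem. The squared entries are `(r + c)^2` on the diagonal, `(1 - c)^2` on
  -- edges and `c^2` elsewhere; testing on an eigenvector for `s` orthogonal to `1` removes the `J`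
  -- term.
  have hM := (h.hadamard h).dotProduct_mulVec_nonneg x
  have hexp : (r • (1 : Matrix W W ℝ) - H.adjMatrix ℝ + c • Matrix.of fun _ _ => (1 : ℝ)) ⊙
      (r • (1 : Matrix W W ℝ) - H.adjMatrix ℝ + c • Matrix.of fun _ _ => (1 : ℝ)) =
      (r ^ 2 + 2 * r * c) • (1 : Matrix W W ℝ) + (1 - 2 * c) • H.adjMatrix ℝ +
        (c ^ 2) • Matrix.of fun _ _ => (1 : ℝ) := by
    ext a b
    by_cases hab : a = b
    · subst hab
      simp [hadamard]; ring
    · by_cases hadj : H.Adj a b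
      · simp [hadamard, hab, hadj]; ring
      · simp [hadamard, hab, hadj]; ring
  have hJx : (Matrix.of fun _ _ => (1 : ℝ) : Matrix W W ℝ) *ᵥ x = 0 := by
    ext a; simp [mulVec, dotProduct, hsum]
  rw [hexp, add_mulVec, add_mulVec, smul_mulVec, smul_mulVec, smul_mulVec, hJx, hAx, one_mulVec,
    smul_zero, add_zero, smul_smul, ← add_smul, star_trivial, dotProduct_smul, smul_eq_mul] at hM
  have hxx : 0 < x ⬝ᵥ x := by
    have := dotProduct_star_self_pos_iff.2 hx
    simpa using this
  have := nonneg_of_mul_nonneg_left hM hxx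
  linarith

end Regular

end ApproxSRG

namespace ApproxSRG

universe u

/-! ### Clique-free sets and the smallest eigenvalue. -/

section Cliques

open Matrix
open scoped Classical

variable {W : Type u} [Fintype W] {H : SimpleGraph W} {k : ℕ}

/-- Hoffman-type bound: every set of vertices of a regular graph spans a vertex of large degree. -/
theorem exists_le_card_filter_adj (hreg : H.IsRegularOfDegree k) {X : Finset W}
    (hX : X.Nonempty) :
    ∃ a ∈ X, (k : ℝ) / Fintype.card W * X.card + smallestEigenvalue H ≤
      ((X.filter fun b => H.Adj a b).card : ℝ) := by
  have : Nonempty W := ⟨hX.choose⟩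
  have hv : (0 : ℝ) < Fintype.card W := by exact_mod_cast Fintype.card_pos
  set s := smallestEigenvalue H with hs
  have hs0 : s ≤ 0 := smallestEigenvalue_nonpos H
  set x : ℝ := (X.card : ℝ) with hx
  have hx0 : 0 ≤ x := Nat.cast_nonneg _
  set c : ℝ := x / Fintype.card W with hc
  have hcv : c * Fintype.card W = x := by rw [hc]; field_simp
  set u : W → ℝ := fun a => if a ∈ X then 1 else 0 with hu
  have hu1 : ∑ a, u a = x := by simp [hu, hx]
  have huu : u ⬝ᵥ u = x := by simp [hu, hx, dotProduct]
  have h1A : (1 : W → ℝ) ⬝ᵥ (H.adjMatrix ℝ *ᵥ u) = k * x := by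
    rw [dotProduct_mulVec, ← mulVec_transpose, H.transpose_adjMatrix, adjMatrix_mulVec_one hreg,
      smul_dotProduct, one_dotProduct, smul_eq_mul, hu1]
  have huA : u ⬝ᵥ (H.adjMatrix ℝ *ᵥ u) =
      ∑ a ∈ X, ((X.filter fun b => H.Adj a b).card : ℝ) := by
    simp only [dotProduct, hu, ite_mul, one_mul, zero_mul, Finset.sum_ite_mem, Finset.univ_inter]
    refine Finset.sum_congr rfl fun a _ => ?_
    simp [mulVec, dotProduct, SimpleGraph.adjMatrix_apply, Finset.inter_comm,
      Finset.sum_ite_mem]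
  have h11 : (1 : W → ℝ) ⬝ᵥ (1 : W → ℝ) = Fintype.card W := by simp [dotProduct]
  have hu1' : u ⬝ᵥ (1 : W → ℝ) = x := by rw [dotProduct_one, hu1]
  have h1u' : (1 : W → ℝ) ⬝ᵥ u = x := by rw [one_dotProduct, hu1]
  -- The test vector is the indicator of `X` projected orthogonally to `1`. The resulting term `-s c
  -- x` is nonnegative and is dropped below; averaging over `X` then yields the vertex.
  have hq := smallestEigenvalue_mul_le H (u - c • (1 : W → ℝ))
  rw [mulVec_sub, mulVec_smul, adjMatrix_mulVec_one hreg] at hq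
  simp only [sub_dotProduct, dotProduct_sub, smul_dotProduct, dotProduct_smul, smul_eq_mul,
    huA, huu, h1A, h11, hu1', h1u', hcv, ← hs] at hq
  have hck : (k : ℝ) / Fintype.card W * x = c * k := by rw [hc]; ring
  have hsum : ∑ _a ∈ X, ((k : ℝ) / Fintype.card W * x + s) ≤
      ∑ a ∈ X, ((X.filter fun b => H.Adj a b).card : ℝ) := by
    rw [Finset.sum_const, nsmul_eq_mul, ← hx, hck]
    have h3 : 0 ≤ c * x := by positivity
    nlinarith [mul_nonneg h3 (neg_nonneg.2 hs0)]
  exact Finset.exists_le_of_sum_le hX hsum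

/-- A set of vertices without large cliques in a regular graph is small in terms of the smallest
eigenvalue. -/
theorem card_mul_pow_le_of_no_clique [Nonempty W] (hreg : H.IsRegularOfDegree k) (t : ℕ) :
    ∀ X : Finset W, (∀ S ⊆ X, ¬ H.IsNClique (t + 1) S) →
      (X.card : ℝ) * ((k : ℝ) / Fintype.card W) ^ t ≤ 2 ^ t * -smallestEigenvalue H := by
  have hs0 := smallestEigenvalue_nonpos H
  have hp : 0 ≤ (k : ℝ) / Fintype.card W := by positivity
  have hp1 : (k : ℝ) / Fintype.card W ≤ 1 := by
    refine div_le_one_of_le₀ ?_ (Nat.cast_nonneg _)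
    have a := Classical.arbitrary W
    rw [← hreg a]
    exact_mod_cast (H.degree_lt_card_verts a).le
  set p := (k : ℝ) / Fintype.card W with hpdef
  induction t with
  | zero =>
    intro X hX
    have : X = ∅ := by
      by_contra hne
      obtain ⟨a, ha⟩ := Finset.nonempty_iff_ne_empty.2 hne
      exact hX {a} (by simpa using ha) (by simp [SimpleGraph.isNClique_iff])
    simp [this, hs0]
  | succ t ih =>
    intro X hX
    rcases X.eq_empty_or_nonempty with rfl | hne
    · simp only [Finset.card_empty, Nat.cast_zero, zero_mul]
      exact mul_nonneg (by positivity) (by linarith)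
    -- Either `X` is already small, or the Hoffman vertex keeps at least `p |X| / 2` neighbours in
    -- `X` and induction applies to them; each step costs a factor `2`.
    rcases le_or_gt (p * X.card) (2 * -smallestEigenvalue H) with h | h
    · calc (X.card : ℝ) * p ^ (t + 1) = p * X.card * p ^ t := by ring
        _ ≤ 2 * -smallestEigenvalue H * 1 :=
          mul_le_mul h (pow_le_one₀ hp hp1) (by positivity) (by linarith)
        _ ≤ 2 ^ (t + 1) * -smallestEigenvalue H := by
          rw [mul_one]
          refine mul_le_mul_of_nonneg_right ?_ (by linarith)
          exact le_self_pow₀ (by norm_num) (by omega)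
    · obtain ⟨a, ha, hdeg⟩ := exists_le_card_filter_adj hreg hne
      have hstep := ih (X.filter fun b => H.Adj a b) fun S hS hcl => by
        refine hX (insert a S) ?_ (hcl.insert fun b hb => (Finset.mem_filter.1 (hS hb)).2)
        exact Finset.insert_subset ha (hS.trans (Finset.filter_subset _ _))
      rw [← hpdef] at hdeg
      have h2 : p * X.card / 2 ≤ ((X.filter fun b => H.Adj a b).card : ℝ) := by linarith
      have h3 := mul_le_mul_of_nonneg_right h2 (pow_nonneg hp t)
      rw [pow_succ, pow_succ]
      linarith

/-- A vertex extends any clique in its neighbourhood, so the neighbourhood contains no `(t +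
1)`-clique. -/
theorem degree_mul_pow_le_of_cliqueFree [Nonempty W] (hreg : H.IsRegularOfDegree k) (t : ℕ)
    (hfree : H.CliqueFree (t + 2)) :
    (k : ℝ) * ((k : ℝ) / Fintype.card W) ^ t ≤ 2 ^ t * -smallestEigenvalue H := by
  have a := Classical.arbitrary W
  have h := card_mul_pow_le_of_no_clique hreg t (H.neighborFinset a) fun S hS hcl =>
    hfree _ (hcl.insert fun b hb => (H.mem_neighborFinset a b).1 (hS hb))
  rwa [H.card_neighborFinset_eq_degree, hreg a] at h

end Cliques

/-! ### Approximate strong regularity as a perturbed quadratic equation. -/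

section Spectrum

open Matrix
open scoped Classical

variable {W : Type u} [Fintype W] {H : SimpleGraph W} {v k : ℕ} {lam mu sig : ℝ}

theorem sum_le_of_mean_le {α : Type u} {P : Finset α} {f : α → ℝ} {c : ℝ}
    (h : mean P f ≤ c) : ∑ p ∈ P, f p ≤ P.card * c := by
  rcases P.eq_empty_or_nonempty with rfl | hne
  · simp
  · have hc : (0 : ℝ) < P.card := by exact_mod_cast hne.card_pos
    rw [mean, div_le_iff₀ hc] at h
    linarith

theorem mean_nonneg {α : Type u} {P : Finset α} {f : α → ℝ} (h : ∀ p ∈ P, 0 ≤ f p) :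
    0 ≤ mean P f :=
  div_nonneg (Finset.sum_nonneg h) (Nat.cast_nonneg _)

theorem commonCount_nonneg {W : Type u} (H : SimpleGraph W) (a b : W) : 0 ≤ commonCount H a b :=
  Nat.cast_nonneg _

theorem adjMatrix_mul_self_apply (H : SimpleGraph W) (a b : W) :
    (H.adjMatrix ℝ * H.adjMatrix ℝ) a b = commonCount H a b := by
  have h : H.commonNeighbors a b =
      ((H.neighborFinset a).filter fun c => H.Adj c b : Finset W) := by
    ext c
    simp [SimpleGraph.mem_commonNeighbors, SimpleGraph.adj_comm]
  rw [SimpleGraph.adjMatrix_mul_apply, commonCount, h, Set.ncard_coe_finset]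
  simp [SimpleGraph.adjMatrix_apply]

theorem commonCount_self (hreg : H.IsRegularOfDegree k) (a : W) : commonCount H a a = k := by
  rw [← adjMatrix_mul_self_apply, SimpleGraph.adjMatrix_mul_self_apply_self, hreg a]

/-- The deviation of the square of the adjacency matrix from that of a strongly regular graph. -/
noncomputable def srgError (H : SimpleGraph W) (k : ℕ) (lam mu : ℝ) : Matrix W W ℝ :=
  H.adjMatrix ℝ * H.adjMatrix ℝ - (k : ℝ) • (1 : Matrix W W ℝ) - lam • H.adjMatrix ℝ -
    mu • ((Matrix.of fun _ _ => (1 : ℝ)) - 1 - H.adjMatrix ℝ)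

theorem srgError_sq_apply (hreg : H.IsRegularOfDegree k) (lam mu : ℝ) (a b : W) :
    srgError H k lam mu a b ^ 2 =
      (if H.Adj a b then (commonCount H a b - lam) ^ 2 else 0) +
        if a ≠ b ∧ ¬ H.Adj a b then (commonCount H a b - mu) ^ 2 else 0 := by
  simp only [srgError, Matrix.sub_apply, Matrix.smul_apply, adjMatrix_mul_self_apply]
  by_cases hab : a = b
  · subst hab
    simp [commonCount_self hreg]
  · by_cases hadj : H.Adj a b <;> simp [hab, hadj]

/-- The diagonal of the error vanishes; the other entries are deviations from the means, so the two
variance bounds apply to at most `v ^ 2` ordered pairs. -/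
theorem sum_srgError_sq_le (h : IsApproxSRG H v k lam mu sig) :
    ∑ a, ∑ b, srgError H k lam mu a b ^ 2 ≤ ((v : ℝ) * sig) ^ 2 := by
  have h1 : ∑ a, ∑ b, srgError H k lam mu a b ^ 2 =
      ∑ p ∈ adjPairs H, (commonCount H p.1 p.2 - lam) ^ 2 +
        ∑ p ∈ nonadjPairs H, (commonCount H p.1 p.2 - mu) ^ 2 := by
    rw [← Fintype.sum_prod_type' (f := fun a b => srgError H k lam mu a b ^ 2), adjPairs,
      nonadjPairs, Finset.sum_filter, Finset.sum_filter, ← Finset.sum_add_distrib]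
    exact Finset.sum_congr rfl fun p _ => srgError_sq_apply h.regular lam mu p.1 p.2
  have hcard : ((adjPairs H).card : ℝ) + (nonadjPairs H).card ≤ (v : ℝ) ^ 2 := by
    have hdisj : Disjoint (adjPairs H) (nonadjPairs H) := by
      rw [adjPairs, nonadjPairs, Finset.disjoint_filter]
      exact fun p _ h1 h2 => h2.2 h1
    have := Finset.card_le_univ (adjPairs H ∪ nonadjPairs H)
    rw [Finset.card_union_of_disjoint hdisj, Fintype.card_prod, h.card_eq] at this
    rw [sq]; exact_mod_cast this
  rw [h1]
  calc _ ≤ ((adjPairs H).card : ℝ) * sig ^ 2 + (nonadjPairs H).card * sig ^ 2 :=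
        add_le_add (sum_le_of_mean_le h.var_adj) (sum_le_of_mean_le h.var_nonadj)
    _ ≤ _ := by rw [← add_mul, mul_pow]; gcongr

/-- The approximate quadratic equation satisfied by the eigenvalues of an approximately strongly
regular graph. -/
theorem eigenvalue_quadratic_le (h : IsApproxSRG H v k lam mu sig) {r : ℝ} {x : W → ℝ}
    (hx : x ≠ 0) (hsum : ∑ a, x a = 0) (hAx : H.adjMatrix ℝ *ᵥ x = r • x) :
    r ^ 2 + (mu - lam) * r ≤ k - mu + v * sig := by
  have hxx : 0 < x ⬝ᵥ x := by
    have := dotProduct_star_self_pos_iff.2 hx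
    simpa using this
  have hq := quadForm_le_of_sum_sq_le (mul_nonneg (Nat.cast_nonneg v) h.sig_nonneg)
    (sum_srgError_sq_le h) x
  have hJx : (Matrix.of fun _ _ => (1 : ℝ) : Matrix W W ℝ) *ᵥ x = 0 := by
    ext a; simp [mulVec, dotProduct, hsum]
  have hEx : srgError H k lam mu *ᵥ x = (r ^ 2 + (mu - lam) * r - (k - mu)) • x := by
    simp only [srgError, sub_mulVec, smul_mulVec, ← mulVec_mulVec, hAx, mulVec_smul, hJx,
      one_mulVec]
    ext a
    simp
    ring
  rw [hEx, dotProduct_smul, smul_eq_mul] at hq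
  have := le_of_mul_le_mul_right hq hxx
  linarith

theorem mu_nonneg (h : IsApproxSRG H v k lam mu sig) : 0 ≤ mu := by
  rw [← h.mean_nonadj]
  exact mean_nonneg fun p _ => commonCount_nonneg H _ _

/-- Double counting of paths of length two in the triangle-free case. -/
theorem degree_mul_pred_le_of_cliqueFree_three (h : IsApproxSRG H v k lam mu sig)
    (hfree : H.CliqueFree 3) : lam = 0 ∧ (k : ℝ) * (k - 1) ≤ mu * v := by
  have hadj : ∀ a b, H.Adj a b → commonCount H a b = 0 := by
    intro a b hab
    rw [commonCount, Nat.cast_eq_zero, Set.ncard_eq_zero]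
    refine Set.eq_empty_iff_forall_notMem.2 fun c hc => ?_
    rw [SimpleGraph.mem_commonNeighbors] at hc
    exact hfree {a, b, c} (SimpleGraph.is3Clique_triple_iff.2 ⟨hab, hc.1, hc.2⟩)
  have hlam : lam = 0 := by
    rw [← h.mean_adj, mean, Finset.sum_eq_zero, zero_div]
    intro p hp
    exact hadj _ _ (by simpa [adjPairs] using hp)
  refine ⟨hlam, ?_⟩
  have hv : (Fintype.card W : ℝ) = v := by exact_mod_cast h.card_eq
  -- Walks of length two, counted as `1ᵀ A² 1`; the closed ones number `v k`, and without triangles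
  -- all others join nonadjacent pairs.
  have htot : ∑ a, ∑ b, commonCount H a b = (v : ℝ) * k ^ 2 := by
    have h1 : ∑ a, ∑ b, commonCount H a b =
        ∑ a, (H.adjMatrix ℝ *ᵥ (H.adjMatrix ℝ *ᵥ (1 : W → ℝ))) a := by
      refine Finset.sum_congr rfl fun a _ => ?_
      rw [mulVec_mulVec, mulVec, dotProduct_one]
      exact Finset.sum_congr rfl fun b _ => (adjMatrix_mul_self_apply H a b).symm
    rw [h1, adjMatrix_mulVec_one h.regular, mulVec_smul, adjMatrix_mulVec_one h.regular]
    simp only [Pi.smul_apply, Pi.one_apply, smul_eq_mul, mul_one, Finset.sum_const,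
      Finset.card_univ, nsmul_eq_mul, hv]
    ring
  have hsplit : ∑ a, ∑ b, commonCount H a b =
      (v : ℝ) * k + ∑ p ∈ nonadjPairs H, commonCount H p.1 p.2 := by
    have h2 : ∀ a b, commonCount H a b = (if a = b then (k : ℝ) else 0) +
        if a ≠ b ∧ ¬ H.Adj a b then commonCount H a b else 0 := by
      intro a b
      by_cases hab : a = b
      · subst hab; simp [commonCount_self h.regular]
      · by_cases hadj' : H.Adj a b
        · simp [hab, hadj', hadj a b hadj']
        · simp [hab, hadj']
    rw [nonadjPairs, Finset.sum_filter, Fintype.sum_prod_type]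
    rw [Finset.sum_congr rfl fun a _ => Finset.sum_congr rfl fun b _ => h2 a b]
    simp_rw [Finset.sum_add_distrib]
    congr 1
    simp [hv]
  have hle := sum_le_of_mean_le h.mean_nonadj.le
  have hcard : ((nonadjPairs H).card : ℝ) ≤ (v : ℝ) * v := by
    have := Finset.card_le_univ (nonadjPairs H)
    rw [Fintype.card_prod, h.card_eq] at this
    exact_mod_cast this
  have hmu := mu_nonneg h
  have hv0 : (0 : ℝ) < v := by
    rw [← h.card_eq]
    have : Nonempty W := by
      by_contra hne
      rw [not_nonempty_iff] at hne
      exact h.not_edgeless (Subsingleton.elim _ _)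
    exact_mod_cast Fintype.card_pos
  have hfin : (v : ℝ) * (k * (k - 1)) ≤ v * (mu * v) := by
    nlinarith [mul_le_mul_of_nonneg_right hcard hmu]
  exact le_of_mul_le_mul_left hfin hv0

end Spectrum

end ApproxSRG

namespace ApproxSRG

universe u

/-! ### The density bound for a single graph, and cliques in links. -/

section SingleGraph

open scoped Classical

variable {W : Type u} [Fintype W] {H : SimpleGraph W} {v k : ℕ} {lam mu sig : ℝ}

theorem degree_pos_of_ne_bot {k : ℕ} (hreg : H.IsRegularOfDegree k) (h : H ≠ ⊥) : 0 < k := by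
  obtain ⟨a, b, hab⟩ := SimpleGraph.ne_bot_iff_exists_adj.1 h
  rw [← hreg a]
  exact (H.degree_pos_iff_exists_adj a).2 ⟨b, hab⟩

theorem nonempty_of_ne_bot {W : Type u} {H : SimpleGraph W} (h : H ≠ ⊥) : Nonempty W := by
  obtain ⟨a, _, _⟩ := SimpleGraph.ne_bot_iff_exists_adj.1 h
  exact ⟨a⟩

/-- The density of a sparse `K_{t+2}`-free approximately strongly regular graph is small, as soon
as `mu - lam` is large enough. -/
theorem degree_mul_density_pow_le (h : IsApproxSRG H v k lam mu sig) {t : ℕ}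
    (hfree : H.CliqueFree (t + 2)) {d : ℝ} (hd0 : 0 < d) (hd1 : d ≤ 1)
    (hp : (k : ℝ) / v ≤ 1 / 4) (hd : d * ((k : ℝ) * ((k : ℝ) / v) ^ t) ≤ mu - lam) :
    (k : ℝ) * ((k : ℝ) / v) ^ (3 * t) ≤
      2 ^ (t + 3) / d ^ 2 * (1 + (sig / ((k : ℝ) / v)) ^ 2) := by
  have hne : Nonempty W := nonempty_of_ne_bot h.not_edgeless
  have hkn : 0 < k := degree_pos_of_ne_bot h.regular h.not_edgeless
  have hk : (0 : ℝ) < k := by exact_mod_cast hkn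
  have hcard : (Fintype.card W : ℝ) = v := by exact_mod_cast h.card_eq
  have hv : (0 : ℝ) < v := by rw [← hcard]; exact_mod_cast Fintype.card_pos
  have hclique := degree_mul_pow_le_of_cliqueFree h.regular t hfree
  obtain ⟨r, hr0, hpsd, hr⟩ := exists_nonneg_shift h.regular
  have hkrein := neg_smallestEigenvalue_le_of_posSemidef h.regular hkn hpsd
  rw [hcard] at hclique hkrein
  have hs := smallestEigenvalue_nonpos H
  have hmu := mu_nonneg h
  have hsig := h.sig_nonneg
  have hp0 : 0 < (k : ℝ) / v := div_pos hk hv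
  have hvp : (v : ℝ) * ((k : ℝ) / v) = k := by field_simp
  generalize smallestEigenvalue H = s at *
  generalize (k : ℝ) / v = p at *
  have hP0 : 0 < p ^ t := pow_pos hp0 t
  have hP1 : p ^ t ≤ 1 := pow_le_one₀ hp0.le (by linarith)
  have hq0 : 0 ≤ sig / p := div_nonneg hsig hp0.le
  have hvs : (v : ℝ) * sig = k * (sig / p) := by rw [← hvp]; field_simp
  -- Drop `r ^ 2` and `μ` from the quadratic inequality and divide by `k`, using `v σ = k (σ / p)`.
  have hrB : r * (d * p ^ t) ≤ 1 + sig / p := by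
    rcases hr with rfl | ⟨x, hx, hsum, hAx⟩
    · rw [zero_mul]; positivity
    · have hquad := eigenvalue_quadratic_le h hx hsum hAx
      have h1 : d * (k * p ^ t) * r ≤ (mu - lam) * r := mul_le_mul_of_nonneg_right hd hr0
      have h2 : (k : ℝ) * (r * (d * p ^ t)) ≤ k * (1 + sig / p) := by nlinarith [sq_nonneg r]
      exact le_of_mul_le_mul_left h2 hk
  set T := 1 + sig / p with hT
  have hdP : 0 < d * p ^ t := mul_pos hd0 hP0
  have hdP1 : d * p ^ t ≤ T := by
    have : d * p ^ t ≤ 1 := mul_le_one₀ hd1 hP0.le hP1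
    linarith
  have hs4 : -s * (d * p ^ t) ^ 2 ≤ 4 * T ^ 2 := by
    -- Here `p ≤ 1/4` enters twice: `1 - 2p ≥ 1/2` and `4rp ≤ r`.
    have h1 : -s ≤ 2 * r ^ 2 + r := by nlinarith
    have h2 : (r * (d * p ^ t)) ^ 2 ≤ T ^ 2 := by gcongr
    have h3 : r * (d * p ^ t) * (d * p ^ t) ≤ T * T := by gcongr
    nlinarith [mul_le_mul_of_nonneg_right h1 (sq_nonneg (d * p ^ t)), sq_nonneg T]
  have hT2 : T ^ 2 ≤ 2 * (1 + (sig / p) ^ 2) := by nlinarith [sq_nonneg (1 - sig / p)]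
  have hmain : (k : ℝ) * p ^ (3 * t) * d ^ 2 ≤ 2 ^ (t + 3) * (1 + (sig / p) ^ 2) := by
    calc (k : ℝ) * p ^ (3 * t) * d ^ 2 = k * p ^ t * (d * p ^ t) ^ 2 := by ring
      _ ≤ 2 ^ t * -s * (d * p ^ t) ^ 2 := by gcongr
      _ = 2 ^ t * (-s * (d * p ^ t) ^ 2) := by ring
      _ ≤ 2 ^ t * (4 * (2 * (1 + (sig / p) ^ 2))) := by
        refine mul_le_mul_of_nonneg_left ?_ (by positivity)
        linarith
      _ = _ := by ring
  rw [div_mul_eq_mul_div, le_div_iff₀ (by positivity)]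
  exact hmain

/-- The same bound for triangle-free graphs, where `mu - lam` is automatically large. -/
theorem degree_mul_density_pow_le_of_cliqueFree_three (h : IsApproxSRG H v k lam mu sig)
    (hfree : H.CliqueFree 3) (hp : (k : ℝ) / v ≤ 1 / 4) :
    (k : ℝ) * ((k : ℝ) / v) ^ 3 ≤ 64 * (1 + (sig / ((k : ℝ) / v)) ^ 2) := by
  have hne : Nonempty W := nonempty_of_ne_bot h.not_edgeless
  have hv : (0 : ℝ) < v := by rw [← h.card_eq]; exact_mod_cast Fintype.card_pos
  have hkn : 0 < k := degree_pos_of_ne_bot h.regular h.not_edgeless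
  obtain ⟨hlam, hmu⟩ := degree_mul_pred_le_of_cliqueFree_three h hfree
  -- For `k = 1` the bound `k (k - 1) ≤ μ v` is void, but the claim is trivial; for `k ≥ 2`, `k - 1
  -- ≥ k / 2` allows `d = 1/2`.
  rcases Nat.lt_or_ge k 2 with hk2 | hk2
  · obtain rfl : k = 1 := by omega
    have h1 : ((1 : ℕ) / v : ℝ) ^ 3 ≤ 1 := pow_le_one₀ (by positivity) (by linarith)
    rw [Nat.cast_one] at *
    nlinarith [sq_nonneg (sig / (1 / (v : ℝ)))]
  · have hk2' : (2 : ℝ) ≤ k := by exact_mod_cast hk2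
    have hd : 1 / 2 * ((k : ℝ) * ((k : ℝ) / v) ^ 1) ≤ mu - lam := by
      rw [hlam, sub_zero, pow_one, ← mul_div_assoc, ← mul_div_assoc, div_le_iff₀ hv]
      nlinarith
    have := degree_mul_density_pow_le h (t := 1) hfree (by norm_num) (by norm_num) hp hd
    norm_num at this ⊢
    exact this

/-- A clique in the link is disjoint from `Y` and joins with it to form a larger clique. -/
theorem cliqueFree_link {V : Type u} {G : SimpleGraph V} {m i : ℕ} (hfree : G.CliqueFree m)
    {Y : Finset V} (hY : G.IsNClique i Y) {t : ℕ} (hm : i + t = m) :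
    (link G Y).CliqueFree t := by
  intro S hS
  have hdisj : Disjoint Y (S.map (Function.Embedding.subtype _)) := by
    rw [Finset.disjoint_left]
    intro y hy hy'
    obtain ⟨x, _, rfl⟩ := Finset.mem_map.1 hy'
    exact G.loopless.irrefl _ (x.2 _ hy)
  refine hfree (Y ∪ S.map (Function.Embedding.subtype _)) ⟨?_, ?_⟩
  · have : Std.Symm G.Adj := ⟨fun _ _ h => h.symm⟩
    rw [Finset.coe_union, SimpleGraph.isClique_iff, Set.pairwise_union_of_symm]
    refine ⟨hY.isClique, ?_, ?_⟩
    · intro x hx y hy hxy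
      obtain ⟨x, hxS, rfl⟩ := Finset.mem_map.1 (Finset.mem_coe.1 hx)
      obtain ⟨y, hyS, rfl⟩ := Finset.mem_map.1 (Finset.mem_coe.1 hy)
      exact hS.isClique hxS hyS fun h => hxy (h ▸ rfl)
    · intro y hy x hx _
      obtain ⟨x, _, rfl⟩ := Finset.mem_map.1 (Finset.mem_coe.1 hx)
      exact x.2 y hy
  · rw [Finset.card_union_of_disjoint hdisj, Finset.card_map, hY.card_eq, hS.card_eq, hm]

end SingleGraph

/-! ### From the link bound to the sparsity of the family. -/

section Asymptotic

/-- If the links of a family of graphs satisfy the bound of `degree_mul_density_pow_le`, then the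
family is sparse. -/
theorem isBigO_of_link_bound {v k k' p' sig : ℕ → ℝ} {i t D : ℕ} (hD : D = i + 3 * t)
    (hv : ∀ n, 0 < v n) (hk : ∀ n, 0 < k n)
    (hdeg : ∃ ε : ℕ → ℝ, Tendsto ε atTop (𝓝 0) ∧
      ∀ n, (1 + ε n) * (k n * (k n / v n) ^ i) ≤ k' n)
    (hdens : ∃ ε : ℕ → ℝ, Tendsto ε atTop (𝓝 0) ∧ ∀ n, (1 + ε n) * (k n / v n) ≤ p' n)
    (hsig : sig =o[atTop] fun n => √(k n) * (k n / v n) ^ ((D : ℝ) / 2 + 1))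
    {K : ℝ} (hK : 0 < K)
    (hmain : ∀ᶠ n in atTop, k' n * p' n ^ (3 * t) ≤ K * (1 + (sig n / p' n) ^ 2)) :
    k =O[atTop] fun n => v n ^ (1 - 1 / ((D : ℝ) + 1)) := by
  obtain ⟨ε, hε, hdeg⟩ := hdeg
  obtain ⟨ε', hε', hdens⟩ := hdens
  -- Each `1 + o(1)` is eventually at least `1/2`: one such factor comes from `k'`, and `3t` from
  -- `p' ^ (3t)`.
  set c : ℝ := (1 / 2) ^ (3 * t + 1) with hc
  have hc0 : 0 < c := by positivity
  -- Chosen so that, after dividing by `p' ≥ q / 2`, the `σ` term is at most half of the main term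
  -- `c k q^D` and can be absorbed.
  have hδ : 0 < √(c / (8 * K)) := by positivity
  have hδ2 : √(c / (8 * K)) ^ 2 = c / (8 * K) := Real.sq_sqrt (by positivity)
  have hB : 0 < 2 * K / c := by positivity
  have hD1 : (0 : ℝ) < (D : ℝ) + 1 := by positivity
  refine IsBigO.of_bound ((2 * K / c) ^ (1 / ((D : ℝ) + 1))) ?_
  filter_upwards [hε.eventually (lt_mem_nhds (by norm_num : (-(1 / 2) : ℝ) < 0)),
    hε'.eventually (lt_mem_nhds (by norm_num : (-(1 / 2) : ℝ) < 0)), hmain, hsig.def hδ]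
    with n h1 h2 h3 h4
  have hvn := hv n
  have hkn := hk n
  have hq : 0 < k n / v n := div_pos hkn hvn
  set q := k n / v n with hqdef
  have hk' : 1 / 2 * (k n * q ^ i) ≤ k' n :=
    (mul_le_mul_of_nonneg_right (by linarith) (by positivity)).trans (hdeg n)
  have hp' : 1 / 2 * q ≤ p' n :=
    (mul_le_mul_of_nonneg_right (by linarith) hq.le).trans (hdens n)
  have hp0 : 0 < p' n := by linarith
  have hk'0 : 0 ≤ k' n := le_trans (by positivity) hk'
  have hlow : c * (k n * q ^ D) ≤ k' n * p' n ^ (3 * t) := by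
    calc c * (k n * q ^ D) = 1 / 2 * (k n * q ^ i) * (1 / 2 * q) ^ (3 * t) := by
          rw [hc, hD]; ring
      _ ≤ _ := by gcongr
  have hsq : (sig n / p' n) ^ 2 ≤ c / (2 * K) * (k n * q ^ D) := by
    rw [Real.norm_eq_abs, Real.norm_of_nonneg (by positivity)] at h4
    have h5 : sig n ^ 2 ≤ (√(c / (8 * K)) * (√(k n) * q ^ ((D : ℝ) / 2 + 1))) ^ 2 := by
      rw [← sq_abs]; gcongr
    have h6 : (q ^ ((D : ℝ) / 2 + 1)) ^ 2 = q ^ D * q ^ 2 := by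
      rw [← Real.rpow_natCast (q ^ _), ← Real.rpow_mul hq.le, ← pow_add, ← Real.rpow_natCast]
      congr 1
      push_cast
      ring
    rw [mul_pow, mul_pow, hδ2, Real.sq_sqrt hkn.le, h6] at h5
    rw [div_pow, div_le_iff₀ (by positivity)]
    calc sig n ^ 2 ≤ c / (8 * K) * (k n * (q ^ D * q ^ 2)) := h5
      _ = c / (2 * K) * (k n * q ^ D) * (1 / 2 * q) ^ 2 := by field_simp; ring
      _ ≤ _ := by gcongr
  have hQ : k n * q ^ D ≤ 2 * K / c := by
    rw [le_div_iff₀ hc0]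
    have h7 : K * (1 + (sig n / p' n) ^ 2) ≤ K * (1 + c / (2 * K) * (k n * q ^ D)) := by gcongr
    have h8 : K * (1 + c / (2 * K) * (k n * q ^ D)) = K + c * (k n * q ^ D) / 2 := by
      field_simp
    linarith
  have hpow : k n ^ (D + 1) ≤ 2 * K / c * v n ^ D := by
    have h9 : k n ^ (D + 1) = k n * q ^ D * v n ^ D := by
      rw [hqdef, div_pow]; field_simp; ring
    rw [h9]; gcongr
  rw [Real.norm_of_nonneg hkn.le, Real.norm_of_nonneg (by positivity)]
  have hroot : k n = (k n ^ (D + 1)) ^ (1 / ((D : ℝ) + 1)) := by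
    rw [← Real.rpow_natCast, ← Real.rpow_mul hkn.le]
    push_cast
    rw [mul_one_div_cancel hD1.ne', Real.rpow_one]
  have hexp : (v n ^ D) ^ (1 / ((D : ℝ) + 1)) = v n ^ (1 - 1 / ((D : ℝ) + 1)) := by
    rw [← Real.rpow_natCast, ← Real.rpow_mul hvn.le]
    congr 1
    field_simp
    ring
  calc k n = (k n ^ (D + 1)) ^ (1 / ((D : ℝ) + 1)) := hroot
    _ ≤ (2 * K / c * v n ^ D) ^ (1 / ((D : ℝ) + 1)) := by gcongr
    _ = _ := by rw [Real.mul_rpow hB.le (by positivity), hexp]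

end Asymptotic

/-! ### Density bounds for families of links. -/

section Family

open scoped Classical

/-- If the smallest eigenvalue of the links is `O(mu - lam)`, then the links satisfy the density
bound of `degree_mul_density_pow_le`. -/
theorem PropertyP2.exists_density_bound {W : ℕ → Type u} [∀ n, Fintype (W n)]
    {H : ∀ n, SimpleGraph (W n)} {v' k' : ℕ → ℕ} {lam mu sig : ℕ → ℝ}
    (hP2 : PropertyP2 H v' k' lam mu sig) {t : ℕ} (hfree : ∀ n, (H n).CliqueFree (t + 2))
    (hdens : Tendsto (fun n => (k' n : ℝ) / (v' n : ℝ)) atTop (𝓝 0)) :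
    ∃ K : ℝ, 0 < K ∧ ∀ᶠ n in atTop, (k' n : ℝ) * ((k' n : ℝ) / v' n) ^ (3 * t) ≤
      K * (1 + (sig n / ((k' n : ℝ) / v' n)) ^ 2) := by
  obtain ⟨C, hC, hs⟩ := hP2.smallest_eigenvalue
  have hC2 : 0 < 2 ^ t * C := by positivity
  -- The clique bound and (P2) give `k' p^t ≤ 2^t C (μ - λ)`; the minimum ensures `d ≤ 1`.
  set d : ℝ := min 1 (1 / (2 ^ t * C)) with hd
  have hd0 : 0 < d := lt_min one_pos (by positivity)
  refine ⟨2 ^ (t + 3) / d ^ 2, by positivity, ?_⟩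
  filter_upwards [hs, hdens.eventually (gt_mem_nhds (by norm_num : (0 : ℝ) < 1 / 4))]
    with n hsn hpn
  have h := hP2.approxSRG n
  have hne : Nonempty (W n) := nonempty_of_ne_bot h.not_edgeless
  have hcl := degree_mul_pow_le_of_cliqueFree h.regular t (hfree n)
  rw [h.card_eq] at hcl
  refine degree_mul_density_pow_le h (hfree n) hd0 (min_le_left _ _) hpn.le ?_
  calc d * ((k' n : ℝ) * ((k' n : ℝ) / v' n) ^ t)
      ≤ 1 / (2 ^ t * C) * (2 ^ t * (C * (mu n - lam n))) := by
        refine mul_le_mul (min_le_right _ _) (hcl.trans ?_) (by positivity) (by positivity)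
        gcongr
    _ = mu n - lam n := by field_simp

theorem exists_density_bound_of_cliqueFree_three {W : ℕ → Type u} [∀ n, Fintype (W n)]
    {H : ∀ n, SimpleGraph (W n)} {v' k' : ℕ → ℕ} {lam mu sig : ℕ → ℝ}
    (hsrg : ∀ n, IsApproxSRG (H n) (v' n) (k' n) (lam n) (mu n) (sig n))
    (hfree : ∀ n, (H n).CliqueFree 3)
    (hdens : Tendsto (fun n => (k' n : ℝ) / (v' n : ℝ)) atTop (𝓝 0)) :
    ∃ K : ℝ, 0 < K ∧ ∀ᶠ n in atTop, (k' n : ℝ) * ((k' n : ℝ) / v' n) ^ (3 * 1) ≤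
      K * (1 + (sig n / ((k' n : ℝ) / v' n)) ^ 2) := by
  refine ⟨64, by norm_num, ?_⟩
  filter_upwards [hdens.eventually (gt_mem_nhds (by norm_num : (0 : ℝ) < 1 / 4))] with n hpn
  exact degree_mul_density_pow_le_of_cliqueFree_three (hsrg n) (hfree n) hpn.le

theorem order_pos_and_degree_pos_of_link {V : Type u} [Fintype V] {G : SimpleGraph V}
    {Y : Finset V} {v k : ℕ} (hv : Fintype.card V = v) (hreg : G.IsRegularOfDegree k)
    (h : link G Y ≠ ⊥) : 0 < v ∧ 0 < k := by
  obtain ⟨a, b, hab⟩ := SimpleGraph.ne_bot_iff_exists_adj.1 h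
  have hG : G.Adj a b := hab
  refine ⟨?_, degree_pos_of_ne_bot hreg (SimpleGraph.ne_bot_iff_exists_adj.2 ⟨_, _, hG⟩)⟩
  rw [← hv]
  exact Fintype.card_pos_iff.2 ⟨a⟩

end Family

end ApproxSRG

theorem mainTheorem2 (m : ℕ) (hm : 5 ≤ m)
    {V : ℕ → Type*} [∀ n, Fintype (V n)] (G : ∀ n, SimpleGraph (V n)) (v k : ℕ → ℕ)
    (hG : ApproxSRG.IsOptimallyPseudorandom G v k)
    (hfree : ∀ n, (G n).CliqueFree m)
    (i : ℕ) (Y : ∀ n, Finset (V n)) (hY : ∀ n, (G n).IsNClique i (Y n))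
    (v' k' : ℕ → ℕ) (lam mu sig : ℕ → ℝ)
    (hsrg : ∀ n, ApproxSRG.IsApproxSRG (ApproxSRG.link (G n) (Y n))
      (v' n) (k' n) (lam n) (mu n) (sig n))
    (hP1 : ApproxSRG.PropertyP1 (fun n => ApproxSRG.link (G n) (Y n)) v k i v'
      (fun n => (k' n : ℝ)))
    (hP2 : ApproxSRG.PropertyP2 (fun n => ApproxSRG.link (G n) (Y n)) v' k' lam mu sig ∨
      i + 3 = m) :
    ((i : ℝ) = 3 / 4 * (m : ℝ) - 3 / 2 →
      sig =o[atTop] (fun n => √(k n : ℝ) *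
        ((k n : ℝ) / (v n : ℝ)) ^ (3 / 4 * (m : ℝ) - 1 / 2)) →
      (fun n => (k n : ℝ)) =O[atTop]
        fun n => (v n : ℝ) ^ (1 - 2 / (3 * (m : ℝ) - 4))) ∧
    (i + 3 = m →
      sig =o[atTop] (fun n => √(k n : ℝ) *
        ((k n : ℝ) / (v n : ℝ)) ^ ((m : ℝ) / 2 + 1)) →
      (fun n => (k n : ℝ)) =O[atTop]
        fun n => (v n : ℝ) ^ (1 - 1 / ((m : ℝ) + 1))) := by
  have hv : ∀ n, (0 : ℝ) < v n := fun n => by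
    exact_mod_cast (ApproxSRG.order_pos_and_degree_pos_of_link (hG.card_eq n) (hG.regular n)
      (hsrg n).not_edgeless).1
  have hk : ∀ n, (0 : ℝ) < k n := fun n => by
    exact_mod_cast (ApproxSRG.order_pos_and_degree_pos_of_link (hG.card_eq n) (hG.regular n)
      (hsrg n).not_edgeless).2
  have hthree : i + 3 = m → ∃ K : ℝ, 0 < K ∧
      ∀ᶠ n in atTop, (k' n : ℝ) * ((k' n : ℝ) / v' n) ^ (3 * 1) ≤
        K * (1 + (sig n / ((k' n : ℝ) / v' n)) ^ 2) := fun him =>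
    ApproxSRG.exists_density_bound_of_cliqueFree_three hsrg
      (fun n => ApproxSRG.cliqueFree_link (hfree n) (hY n) him) hP1.density_tendsto
  constructor
  · intro hi hsig
    have hi4 : 4 * i + 6 = 3 * m := by
      have : (4 * i + 6 : ℝ) = 3 * m := by linarith
      exact_mod_cast this
    -- Integrality of `i` forces this form; links are then `K_{t+2}`-free and `D = i + 3t = 6t`.
    obtain ⟨t, rfl, rfl⟩ : ∃ t, i = 3 * t ∧ m = 4 * t + 2 := ⟨i / 3, by omega, by omega⟩
    obtain ⟨K, hK, hmain⟩ : ∃ K : ℝ, 0 < K ∧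
        ∀ᶠ n in atTop, (k' n : ℝ) * ((k' n : ℝ) / v' n) ^ (3 * t) ≤
          K * (1 + (sig n / ((k' n : ℝ) / v' n)) ^ 2) := by
      rcases hP2 with hP2 | him
      · exact hP2.exists_density_bound
          (fun n => ApproxSRG.cliqueFree_link (hfree n) (hY n) (by omega)) hP1.density_tendsto
      · obtain rfl : t = 1 := by omega
        exact hthree him
    have he : 3 / 4 * ((4 * t + 2 : ℕ) : ℝ) - 1 / 2 = ((6 * t : ℕ) : ℝ) / 2 + 1 := by
      push_cast; ring
    have he' : 1 - 2 / (3 * ((4 * t + 2 : ℕ) : ℝ) - 4) = 1 - 1 / (((6 * t : ℕ) : ℝ) + 1) := by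
      have h1 : 3 * ((4 * t + 2 : ℕ) : ℝ) - 4 = 2 * (((6 * t : ℕ) : ℝ) + 1) := by push_cast; ring
      rw [h1, div_mul_eq_div_div, div_self two_ne_zero]
    rw [he] at hsig
    rw [he']
    exact ApproxSRG.isBigO_of_link_bound (by omega) hv hk hP1.degree_ge hP1.density_ge hsig hK hmain
  -- Here `t = 1`, so `D = i + 3 = m`.
  · intro him hsig
    obtain ⟨K, hK, hmain⟩ := hthree him
    exact ApproxSRG.isBigO_of_link_bound (by omega) hv hk hP1.degree_ge hP1.density_ge hsig hK hmain
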